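/- Consider $M$ users. For users $i,j$ let $W_{ij}$ be an almost surely nonnegative random variable (the channel power gain from transmitter $j$ to receiver $i$), and let $N_i>0$ be the noise power at receiver $i$. At transmission powers $P=(P_1,\dots,P_M)$ and target SINR $S_i>0$, user $i$ is in outage if $$\frac{P_iW_{ii}}{N_i+\sum_{j\neq i}P_jW_{ij}}\le S_i .$$ The reliability function of user $i$ is the probability that user $i$ is not in outage when $S_i=e^{\tilde S_i}$ and $P_j=e^{\tilde P_j}$, as a function $\Phi_i(\tilde S_i,\tilde P)$ of $\tilde S_i\in\mathbb R$ and $\tilde P\in\mathbb R^M$. A function $f\ge 0$ on a real vector space is called log-concave if $f(ax+by)\ge f(x)^af(y)^b$ for all $x,y$ and all $a,b>0$ with $a+b=1$. Let $\exp(w)$ denote the componentwise exponential of $w\in\mathbb R^M$. (1) Fix a user $i$ and suppose that the row $W_i=(W_{i1},\dots,W_{iM})$ has a joint density $f_{W_i}$. Then, with $\tilde W_{ij}=\ln W_{ij}$, $$\Phi_i(\tilde S_i,\tilde P)=\Pr\Bigl\{\tilde W_{ii}>\ln\Bigl(e^{\tilde S_i-\tilde P_i+\ln N_i}+\sum_{j\ne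 i}e^{\tilde S_i-\tilde P_i+\tilde P_j+\tilde W_{ij}}\Bigr)\Bigr\}.$$ If $w\mapsto f_{W_i}(\exp(w))$ is log-concave on $\mathbb R^M$, then $\Phi_i$ is log-concave jointly in $(\tilde S_i,\tilde P)\in\mathbb R\times\mathbb R^M$. (2) Suppose that every row $W_i$ has a density $f_{W_i}$ such that $w\mapsto f_{W_i}(\exp(w))$ is log-concave. Let $L_i>0$ be packet lengths, $\bar P_i>0$ power limits, $q_i\in[0,1]$ outage limits, and let $J$ be a convex cost function of the completion times $T\in(0,\infty)^M$. Consider the outage-constrained completion-time minimization: minimize $J(T)$ over $T_i$, $S_i>0$, $P_i$ subject to $T_i\ge L_i/\log_2(1+S_i)$, $\Pr\{\text{user } i\text{ in outage}\}\le q_i$ and $0\le P_i\le\bar P_i$ for all $i$. Under the change of variables $\tilde S_i=\ln S_i$, $\tilde P_i=\ln P_i$, its feasible points with positive powers correspond exactly to the feasible points of the following problem, which is a convex program (convex objective, and inequality constraints given by convex, possibly $+\infty$-valued, functions): minimize $J(T)$ over $T\in(0,\infty)^M$ and $\tilde S,\tilde P\in\mathbb R^M$ subject to $$T_i\ge\frac{L_i}{\log_2(1+e^{\tilde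 S_i})},\qquad \ln\Phi_i(\tilde S_i,\tilde P)\ge\ln(1-q_i),\qquad \tilde P_i\le\ln\bar P_i\qquad(i=1,\dots,M),$$ where $\ln 0=-\infty$. If the outage constraint is imposed with strict inequality, $\Pr\{\text{user } i\text{ in outage}\}<q_i$, the feasible set in the variables $(T,\tilde S,\tilde P)$ is convex as well. (3) Suppose that for each $i$ the gains $W_{i1},\dots,W_{iM}$ are independent, and that each $W_{ij}$ is of one of the following types, with parameters that may depend on $(i,j)$: Rayleigh fading ($\sqrt{W_{ij}}$ is Rayleigh distributed), Nakagami fading ($\sqrt{W_{ij}}$ is Nakagami distributed with shape $m\ge 1/2$), or log-normal ($\ln W_{ij}$ is normal with positive variance). Then every row $W_i$ has a density such that $w\mapsto f_{W_i}(\exp(w))$ is log-concave; hence every $\Phi_i$ is log-concave, and the outage-constrained completion-time minimization is a convex program in the sense of (2). -/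

import Mathlib

open MeasureTheory ProbabilityTheory

noncomputable section

/-- Log-concavity of a nonnegative real function on a real vector space, in multiplicative form
(so that the value `0`, that is `ln 0 = -∞`, is allowed). -/
def LogConcave {E : Type*} [AddCommGroup E] [Module ℝ E] (f : E → ℝ) : Prop :=
  (∀ x, 0 ≤ f x) ∧
    ∀ (x y : E) (a b : ℝ), 0 < a → 0 < b → a + b = 1 →
      f x ^ a * f y ^ b ≤ f (a • x + b • y)

/-- Convexity on `D` of an extended-real-valued function: its epigraph over `D` is convex. -/
def ExtConvexOn {E : Type*} [AddCommGroup E] [Module ℝ E] (D : Set E) (f : E → EReal) : Prop :=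
  Convex ℝ {p : E × ℝ | p.1 ∈ D ∧ f p.1 ≤ (p.2 : EReal)}

/-- The natural logarithm of a nonnegative real number, with `ln 0 = -∞`. -/
def extLn (x : ℝ) : EReal := ENNReal.log (ENNReal.ofReal x)

/-- The optimization problem: minimize `objective x` over `x ∈ domain` subject to
`constraint k x ≤ bound k` for all `k`. -/
structure OptProgram (E κ : Type*) where
  domain : Set E
  objective : E → ℝ
  constraint : κ → E → EReal
  bound : κ → EReal

namespace OptProgram

variable {E κ : Type*}

/-- The feasible points of an optimization problem. -/
def feasibleSet (p : OptProgram E κ) : Set E :=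
  {x | x ∈ p.domain ∧ ∀ k, p.constraint k x ≤ p.bound k}

/-- A convex optimization problem: the domain, the objective and all the functions that define
the inequality constraints are convex. -/
def IsConvex [AddCommGroup E] [Module ℝ E] (p : OptProgram E κ) : Prop :=
  ConvexOn ℝ p.domain p.objective ∧ ∀ k, ExtConvexOn p.domain (p.constraint k)

end OptProgram

/-- The random vector `X` has the (nonnegative, measurable) probability density function `f`
with respect to Lebesgue measure. -/
def HasDensity {Ω : Type*} [MeasurableSpace Ω] (μ : Measure Ω) {M : ℕ}
    (X : Ω → Fin M → ℝ) (f : (Fin M → ℝ) → ℝ) : Prop :=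
  Measurable f ∧ (∀ w, 0 ≤ f w) ∧
    μ.map X = (volume : Measure (Fin M → ℝ)).withDensity (fun w => ENNReal.ofReal (f w))

/-- Signal to interference-plus-noise ratio at receiver `i`, for the noise powers `N`, the channel
power gains `h j` from transmitter `j` to receiver `i`, and the transmission powers `P`. -/
def sinr {M : ℕ} (N : Fin M → ℝ) (i : Fin M) (h : Fin M → ℝ) (P : Fin M → ℝ) : ℝ :=
  P i * h i / (N i + ∑ j ∈ Finset.univ.erase i, P j * h j)

section Network

variable {Ω : Type*} [MeasurableSpace Ω] (μ : Measure Ω) {M : ℕ}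
  (W : Fin M → Fin M → Ω → ℝ) (N L Pbar q : Fin M → ℝ)

/-- The event that user `i` is in outage: the realized SINR does not exceed the target `s`. -/
def outageEvent (i : Fin M) (s : ℝ) (P : Fin M → ℝ) : Set Ω :=
  {ω | sinr N i (fun j => W i j ω) P ≤ s}

/-- The reliability function of user `i`: the probability that user `i` is not in outage, as a
function of the logarithm `S` of the target SINR of user `i` and the logarithms `P` of the
powers. -/
def reliability (i : Fin M) (S : ℝ) (P : Fin M → ℝ) : ℝ :=
  μ.real (outageEvent W N i (Real.exp S) (fun j => Real.exp (P j)))ᶜ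

/-- The condition on the fading of user `i`: the `i`-th row of channel power gains has a joint
density `f` such that `w ↦ f (exp w)` (with the componentwise exponential) is log-concave. -/
def LogConcaveFading (i : Fin M) : Prop :=
  ∃ f : (Fin M → ℝ) → ℝ, HasDensity μ (fun ω j => W i j ω) f ∧
    LogConcave (fun w : Fin M → ℝ => f (fun j => Real.exp (w j)))

/-- Feasibility of completion times `T`, target SINRs `S` and powers `P` in the
outage-constrained completion-time minimization in the original variables; `rel` is the relation
`≤` or `<` that is required between the outage probability of user `i` and `q i`. A target SINR
is positive, since otherwise no finite completion time is possible. -/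
def OutageFeasible (rel : ℝ → ℝ → Prop) (T S P : Fin M → ℝ) : Prop :=
  ∀ i, 0 < S i ∧ L i / Real.logb 2 (1 + S i) ≤ T i ∧
    rel (μ.real (outageEvent W N i (S i) P)) (q i) ∧ 0 ≤ P i ∧ P i ≤ Pbar i

/-- The outage-constrained completion-time minimization in the variables `(T, S, P)`, where `S`
and `P` are now the logarithms of the target SINRs and of the powers:
minimize `J T` subject to `L i / log₂ (1 + exp (S i)) ≤ T i`,
`ln (1 - q i) ≤ ln (Φ i (S i) P)` and `P i ≤ ln (Pbar i)`. -/
def outageProgram (J : (Fin M → ℝ) → ℝ) :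
    OptProgram ((Fin M → ℝ) × (Fin M → ℝ) × (Fin M → ℝ)) (Fin M ⊕ Fin M ⊕ Fin M) where
  domain := {x | ∀ i, 0 < x.1 i}
  objective := fun x => J x.1
  constraint := fun k x => match k with
    | .inl i => ((L i / Real.logb 2 (1 + Real.exp (x.2.1 i)) - x.1 i : ℝ) : EReal)
    | .inr (.inl i) => - extLn (reliability μ W N i (x.2.1 i) x.2.2)
    | .inr (.inr i) => ((x.2.2 i : ℝ) : EReal)
  bound := fun k => match k with
    | .inl _ => 0
    | .inr (.inl i) => - extLn (1 - q i)
    | .inr (.inr i) => ((Real.log (Pbar i) : ℝ) : EReal)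

/-- The outage-constrained completion-time minimization is a convex program in the logarithmic
variables: the transformed problem is a convex optimization problem; the change of variables
turns its feasible set into that of the original problem with positive powers (the objective `J T`
is the same); and when the outage probabilities are required to be strictly below `q i`,
the feasible set in the logarithmic variables is convex as well. -/
def PosedAsConvexProgram (J : (Fin M → ℝ) → ℝ) : Prop :=
  (outageProgram μ W N L Pbar q J).IsConvex ∧
  (∀ T S P : Fin M → ℝ,
    OutageFeasible μ W N L Pbar q (· ≤ ·) T (fun i => Real.exp (S i)) (fun i => Real.exp (P i)) ↔
      (T, S, P) ∈ (outageProgram μ W N L Pbar q J).feasibleSet) ∧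
  Convex ℝ {x : (Fin M → ℝ) × (Fin M → ℝ) × (Fin M → ℝ) |
    OutageFeasible μ W N L Pbar q (· < ·) x.1
      (fun i => Real.exp (x.2.1 i)) (fun i => Real.exp (x.2.2 i))}

end Network

/-- The Rayleigh distribution with scale `σ`. -/
def rayleighDist (σ : ℝ) : Measure ℝ :=
  (volume.restrict (Set.Ioi 0)).withDensity
    (fun x => ENNReal.ofReal (x / σ ^ 2 * Real.exp (-(x ^ 2) / (2 * σ ^ 2))))

/-- The Nakagami distribution with shape `m` and spread `v` (the mean of the square). -/
def nakagamiDist (m v : ℝ) : Measure ℝ :=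
  (volume.restrict (Set.Ioi 0)).withDensity
    (fun x => ENNReal.ofReal
      (2 * m ^ m / (Real.Gamma m * v ^ m) * x ^ (2 * m - 1) * Real.exp (-(m / v) * x ^ 2)))

/-- The log-normal distribution: the law of `exp Z` with `Z` normal of mean `a` and
variance `v`. -/
def logNormalDist (a : ℝ) (v : NNReal) : Measure ℝ := (gaussianReal a v).map Real.exp

/-- The channel power gain `X` has Rayleigh, Nakagami or log-normal fading: its amplitude `√X` is
Rayleigh or Nakagami distributed, or `X` is log-normal. -/
def IsStandardFading {Ω : Type*} [MeasurableSpace Ω] (μ : Measure Ω) (X : Ω → ℝ) : Prop :=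
  (∃ σ : ℝ, 0 < σ ∧ μ.map (fun ω => Real.sqrt (X ω)) = rayleighDist σ) ∨
  (∃ m v : ℝ, 1 / 2 ≤ m ∧ 0 < v ∧ μ.map (fun ω => Real.sqrt (X ω)) = nakagamiDist m v) ∨
  (∃ (a : ℝ) (v : NNReal), v ≠ 0 ∧ μ.map X = logNormalDist a v)

end

/-! In logarithmic coordinates non-outage is a convex condition. With gains `exp (v j)`, dividing
the SINR inequality by the received signal power turns it into "a sum of exponentials of affine
functions of `(S, P, v)` is less than 1" (`convex_exp_lt_sinr`). The substitution `w = exp v` costs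
the Jacobian `exp (∑ v j)`, which is log-linear. The reliability is therefore the integral over `v`
of a jointly log-concave function of `((S, P), v)`: the indicator of a convex set, times `f (exp
v)`, times the Jacobian (`reliability_eq_lintegral`). By Prékopa's theorem,
`LogConcave.lintegral_toReal`, integrating out `v` preserves log-concavity.

Prékopa's theorem is the inequality `prekopa_leindler` applied to the fibres of the integrand. In
dimension one that inequality comes from Brunn–Minkowski on superlevel sets; Tonelli and induction
give the other dimensions.

For the optimization problem, log-concavity makes `-ln Φ` convex with values in `EReal` and makes
the superlevel sets of `Φ` convex. The remaining nonlinear constraint is convex by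
`convexOn_inv_log_one_add_exp`. Independent standard fading has a product density, and each factor,
read at `exp w`, is the exponential of an explicit concave function. -/

/-! ### Brunn–Minkowski on the line and the Prékopa–Leindler inequality -/

/-- The one-dimensional Brunn–Minkowski inequality. -/
theorem Real.volume_add_volume_le_of_forall_add_mem {A B C : Set ℝ} (hA : A.Nonempty)
    (hB : B.Nonempty) (mA : MeasurableSet A) (mB : MeasurableSet B)
    (h : ∀ x ∈ A, ∀ y ∈ B, x + y ∈ C) : volume A + volume B ≤ volume C := by
  have compact_case : ∀ K ⊆ A, IsCompact K → K.Nonempty → ∀ L ⊆ B, IsCompact L → L.Nonempty →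
      volume K + volume L ≤ volume C := by
    intro K hKA hK hKne L hLB hL hLne
    -- The translates `K + l` and `L + m` both lie in `C`. The first is to the left of `m + l` and
    -- the second to the right, so they overlap in a null set.
    obtain ⟨m, hmK, hm⟩ := hK.exists_isGreatest hKne
    obtain ⟨l, hlL, hl⟩ := hL.exists_isLeast hLne
    have h1 : volume ((fun z => z + -l) ⁻¹' K) = volume K := measure_preimage_add_right volume _ _
    have h2 : volume ((fun z => z + -m) ⁻¹' L) = volume L := measure_preimage_add_right volume _ _
    have hinter : volume (((fun z => z + -l) ⁻¹' K) ∩ ((fun z => z + -m) ⁻¹' L)) = 0 := by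
      refine measure_mono_null (t := {m + l}) ?_ (by simp)
      rintro z ⟨hz1, hz2⟩
      have h3 := hm hz1
      have h4 := hl hz2
      simp only [Set.mem_singleton_iff]
      linarith
    have hmeas : MeasurableSet ((fun z => z + -m) ⁻¹' L) :=
      (measurable_add_const (-m)) hL.measurableSet
    rw [← h1, ← h2, ← measure_union_add_inter _ hmeas, hinter, add_zero]
    refine measure_mono ?_
    rintro z (hz | hz)
    · have := h _ (hKA hz) _ (hLB hlL)
      simpa using this
    · have := h _ (hKA hmK) _ (hLB hz)
      simpa using this
  obtain ⟨a, ha⟩ := hA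
  obtain ⟨b, hb⟩ := hB
  rw [mA.measure_eq_iSup_isCompact, mB.measure_eq_iSup_isCompact]
  simp only [iSup_and']
  refine ENNReal.biSup_add_biSup_le' ⟨∅, by simp⟩ ⟨∅, by simp⟩ ?_
  rintro K ⟨hKA, hK⟩ L ⟨hLB, hL⟩
  -- Inner regularity may produce empty compact sets; adding the points `a` and `b` makes them
  -- nonempty without shrinking them.
  refine le_trans ?_ (compact_case (insert a K) (Set.insert_subset ha hKA) (hK.insert a)
    (Set.insert_nonempty _ _) (insert b L) (Set.insert_subset hb hLB) (hL.insert b)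
    (Set.insert_nonempty _ _))
  gcongr <;> exact Set.subset_insert _ _

open scoped Pointwise in
theorem Real.mul_volume_add_mul_volume_le {A B C : Set ℝ} {a b : ℝ} (ha : 0 < a) (hb : 0 < b)
    (hA : A.Nonempty) (hB : B.Nonempty) (mA : MeasurableSet A) (mB : MeasurableSet B)
    (h : ∀ x ∈ A, ∀ y ∈ B, a * x + b * y ∈ C) :
    ENNReal.ofReal a * volume A + ENNReal.ofReal b * volume B ≤ volume C := by
  have hs : ∀ c : ℝ, 0 < c → ∀ D : Set ℝ, volume (c • D) = ENNReal.ofReal c * volume D := by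
    intro c hc D
    rw [Measure.addHaar_smul]
    simp [abs_of_pos hc]
  rw [← hs a ha, ← hs b hb]
  refine Real.volume_add_volume_le_of_forall_add_mem hA.smul_set hB.smul_set
    (mA.const_smul_of_ne_zero ha.ne') (mB.const_smul_of_ne_zero hb.ne') ?_
  rintro _ ⟨x, hx, rfl⟩ _ ⟨y, hy, rfl⟩
  exact h x hx y hy

/-- The one-dimensional Prékopa–Leindler inequality for functions with supremum `1`, in additive
form. -/
theorem Real.lintegral_add_le_of_sup_eq_one {f g h : ℝ → ℝ} {a b : ℝ} (ha : 0 < a) (hb : 0 < b)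
    (hab : a + b = 1) (mf : Measurable f) (mg : Measurable g) (mh : Measurable h)
    (f0 : ∀ x, 0 ≤ f x) (g0 : ∀ x, 0 ≤ g x) (h0 : ∀ x, 0 ≤ h x)
    (f1 : ∀ x, f x ≤ 1) (g1 : ∀ x, g x ≤ 1)
    (hf : ∀ t < 1, ∃ x, t < f x) (hg : ∀ t < 1, ∃ x, t < g x)
    (H : ∀ x y, f x ^ a * g y ^ b ≤ h (a * x + b * y)) :
    ENNReal.ofReal a * (∫⁻ x, ENNReal.ofReal (f x)) + ENNReal.ofReal b * (∫⁻ x, ENNReal.ofReal (g x))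
      ≤ ∫⁻ x, ENNReal.ofReal (h x) := by
  have anti : ∀ k : ℝ → ℝ, Measurable (fun t => volume {x | t < k x}) := fun k =>
    Antitone.measurable fun s t hst => measure_mono fun x (hx : t < k x) => lt_of_le_of_lt hst hx
  rw [lintegral_eq_lintegral_meas_lt volume (.of_forall f0) mf.aemeasurable,
    lintegral_eq_lintegral_meas_lt volume (.of_forall g0) mg.aemeasurable,
    lintegral_eq_lintegral_meas_lt volume (.of_forall h0) mh.aemeasurable,
    ← lintegral_const_mul _ (anti f), ← lintegral_const_mul _ (anti g),
    ← lintegral_add_left ((anti f).const_mul _)]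
  refine setLIntegral_mono (anti h) fun t ht => ?_
  -- Layer-cake comparison at level `t`. Below 1 both superlevel sets are nonempty because the
  -- suprema equal 1, as Brunn–Minkowski requires; from 1 on they are empty.
  rcases lt_or_ge t 1 with ht1 | ht1
  · refine Real.mul_volume_add_mul_volume_le ha hb (hf t ht1) (hg t ht1)
      (measurableSet_lt measurable_const mf) (measurableSet_lt measurable_const mg) ?_
    intro x hx y hy
    refine lt_of_lt_of_le ?_ (H x y)
    have ht0 : (0 : ℝ) < t := ht
    calc t = t ^ a * t ^ b := by rw [← Real.rpow_add ht0, hab, Real.rpow_one]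
      _ < f x ^ a * g y ^ b := by
        apply mul_lt_mul'' (Real.rpow_lt_rpow ht0.le hx ha) (Real.rpow_lt_rpow ht0.le hy hb) <;>
        positivity
  · have e1 : {x | t < f x} = ∅ := by
      ext x; simpa using (f1 x).trans ht1
    have e2 : {x | t < g x} = ∅ := by
      ext x; simpa using (g1 x).trans ht1
    simp [e1, e2]

/-- Weighted AM–GM, which is Young's inequality with conjugate exponents `a⁻¹` and `b⁻¹`. It turns
the additive form of Prékopa–Leindler into the multiplicative one. -/
theorem ENNReal.rpow_mul_rpow_le_add (u v : ENNReal) {a b : ℝ} (ha : 0 < a) (hb : 0 < b)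
    (hab : a + b = 1) :
    u ^ a * v ^ b ≤ ENNReal.ofReal a * u + ENNReal.ofReal b * v := by
  have hpq : (a⁻¹).HolderConjugate b⁻¹ := by
    rw [Real.holderConjugate_iff]
    refine ⟨?_, by simpa using hab⟩
    rw [one_lt_inv₀ ha]; linarith
  have := ENNReal.young_inequality (u ^ a) (v ^ b) hpq
  rw [← ENNReal.rpow_mul, ← ENNReal.rpow_mul, mul_inv_cancel₀ ha.ne', mul_inv_cancel₀ hb.ne',
    ENNReal.rpow_one, ENNReal.rpow_one, ENNReal.div_eq_inv_mul, ENNReal.div_eq_inv_mul,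
    ENNReal.ofReal_inv_of_pos ha, ENNReal.ofReal_inv_of_pos hb, inv_inv, inv_inv] at this
  exact this

/-- The one-dimensional Prékopa–Leindler inequality for bounded functions. -/
theorem Real.prekopa_leindler_of_bounded {f g h : ℝ → ENNReal} {a b : ℝ} (ha : 0 < a) (hb : 0 < b)
    (hab : a + b = 1) (mf : Measurable f) (mg : Measurable g) (mh : Measurable h)
    (hf : ⨆ x, f x ≠ ⊤) (hg : ⨆ x, g x ≠ ⊤)
    (H : ∀ x y, f x ^ a * g y ^ b ≤ h (a * x + b * y)) :
    (∫⁻ x, f x) ^ a * (∫⁻ x, g x) ^ b ≤ ∫⁻ x, h x := by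
  have key : ∀ k : ℝ → ENNReal, ⨆ x, k x ≠ ⊤ → ⨆ x, k x ≠ 0 →
      (∀ x, k x / (⨆ x, k x) ≤ 1) ∧
      (∀ t < (1 : ℝ), ∃ x, t < (k x / (⨆ x, k x)).toReal) := by
    intro k hk hk0
    have h1 : ∀ x, k x / (⨆ x, k x) ≤ 1 := fun x =>
      ENNReal.div_le_of_le_mul (by rw [one_mul]; exact le_iSup k x)
    refine ⟨h1, fun t ht => ?_⟩
    rcases lt_or_ge t 0 with ht0 | ht0
    · exact ⟨0, ht0.trans_le ENNReal.toReal_nonneg⟩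
    have : ENNReal.ofReal t * (⨆ x, k x) < ⨆ x, k x := by
      conv_rhs => rw [← one_mul (⨆ x, k x)]
      exact ENNReal.mul_lt_mul_left hk0 hk (by simpa using ht)
    obtain ⟨x, hx⟩ := lt_iSup_iff.1 this
    refine ⟨x, ?_⟩
    rw [← ENNReal.ofReal_lt_iff_lt_toReal ht0 (ne_top_of_le_ne_top (by simp) (h1 x))]
    rwa [ENNReal.lt_div_iff_mul_lt (.inl hk0) (.inl hk)]
  set α := ⨆ x, f x with hα
  set β := ⨆ x, g x with hβ
  by_cases hα0 : α = 0
  · have : ∀ x, f x = 0 := by simpa [hα] using hα0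
    simp [this, ha]
  by_cases hβ0 : β = 0
  · have : ∀ x, g x = 0 := by simpa [hβ] using hβ0
    simp [this, hb]
  obtain ⟨f1, f2⟩ := key f hf hα0
  obtain ⟨g1, g2⟩ := key g hg hβ0
  set γ := α ^ a * β ^ b with hγ
  have hγ0 : γ ≠ 0 := mul_ne_zero (by simp [hα0, hf]) (by simp [hβ0, hg])
  have hγt : γ ≠ ⊤ := ENNReal.mul_ne_top (ENNReal.rpow_ne_top_of_nonneg ha.le hf)
    (ENNReal.rpow_ne_top_of_nonneg hb.le hg)
  have hdiv : ∀ u v, (u / α) ^ a * (v / β) ^ b = u ^ a * v ^ b / γ := by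
    intro u v
    rw [ENNReal.div_rpow_of_nonneg _ _ ha.le, ENNReal.div_rpow_of_nonneg _ _ hb.le, hγ,
      div_eq_mul_inv, div_eq_mul_inv, div_eq_mul_inv, ENNReal.mul_inv]
    · ring
    · right; exact ENNReal.rpow_ne_top_of_nonneg hb.le hg
    · left; exact ENNReal.rpow_ne_top_of_nonneg ha.le hf
  -- Dividing by the suprema normalizes `f` and `g`, and `γ` is the matching factor for `h`. Capping
  -- `h / γ` at 1 makes it finite, so `toReal` loses nothing; the hypothesis survives because the
  -- normalized left side is at most 1.
  have main := Real.lintegral_add_le_of_sup_eq_one ha hb hab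
    (mf.div_const α).ennreal_toReal (mg.div_const β).ennreal_toReal
    ((mh.div_const γ).min measurable_const).ennreal_toReal (h := fun x => (min (h x / γ) 1).toReal)
    (fun _ => ENNReal.toReal_nonneg) (fun _ => ENNReal.toReal_nonneg)
    (fun _ => ENNReal.toReal_nonneg)
    (fun x => ENNReal.toReal_mono (by simp) (f1 x)) (fun x => ENNReal.toReal_mono (by simp) (g1 x))
    f2 g2 (by
      intro x y
      rw [ENNReal.toReal_rpow, ENNReal.toReal_rpow, ← ENNReal.toReal_mul]
      refine ENNReal.toReal_mono (ne_top_of_le_ne_top ENNReal.one_ne_top (min_le_right _ _))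
        (le_min ?_ ?_)
      · rw [hdiv]
        exact ENNReal.div_le_div_right (H x y) _
      · exact mul_le_one' (ENNReal.rpow_le_one (f1 x) ha.le) (ENNReal.rpow_le_one (g1 y) hb.le))
  have e1 : ∫⁻ x, ENNReal.ofReal (f x / α).toReal = (∫⁻ x, f x) / α := by
    refine (lintegral_congr fun x =>
      ENNReal.ofReal_toReal (ne_top_of_le_ne_top ENNReal.one_ne_top (f1 x))).trans ?_
    simp_rw [div_eq_mul_inv]
    exact lintegral_mul_const _ mf
  have e2 : ∫⁻ x, ENNReal.ofReal (g x / β).toReal = (∫⁻ x, g x) / β := by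
    refine (lintegral_congr fun x =>
      ENNReal.ofReal_toReal (ne_top_of_le_ne_top ENNReal.one_ne_top (g1 x))).trans ?_
    simp_rw [div_eq_mul_inv]
    exact lintegral_mul_const _ mg
  have e3 : ∫⁻ x, ENNReal.ofReal (min (h x / γ) 1).toReal ≤ (∫⁻ x, h x) / γ := by
    simp_rw [ENNReal.ofReal_toReal
      (ne_top_of_le_ne_top ENNReal.one_ne_top (min_le_right (h _ / γ) 1))]
    refine (lintegral_mono fun x => min_le_left _ _).trans_eq ?_
    simp_rw [div_eq_mul_inv]
    exact lintegral_mul_const _ mh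
  rw [e1, e2] at main
  have := (ENNReal.rpow_mul_rpow_le_add _ _ ha hb hab).trans (main.trans e3)
  rw [hdiv, ENNReal.div_le_iff hγ0 hγt, ENNReal.div_mul_cancel hγ0 hγt] at this
  exact this

theorem ENNReal.iSup_rpow_of_pos {ι : Sort*} (u : ι → ENNReal) {a : ℝ} (ha : 0 < a) :
    (⨆ i, u i) ^ a = ⨆ i, u i ^ a :=
  (ENNReal.orderIsoRpow a ha).map_iSup u

/-- Monotone convergence for truncations; it removes the boundedness assumption from
Prékopa–Leindler. -/
theorem MeasureTheory.lintegral_eq_iSup_lintegral_min_natCast {α : Type*} [MeasurableSpace α]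
    {μ : Measure α} {f : α → ENNReal} (mf : Measurable f) :
    ∫⁻ x, f x ∂μ = ⨆ n : ℕ, ∫⁻ x, min (f x) n ∂μ := by
  rw [← lintegral_iSup (fun n => mf.min measurable_const)]
  · congr with x
    change f x = ⨆ n : ℕ, f x ⊓ n
    rw [← inf_iSup_eq, ENNReal.iSup_natCast, inf_top_eq]
  · intro m n hmn x
    exact min_le_min_left _ (by exact_mod_cast hmn)

/-- The one-dimensional Prékopa–Leindler inequality. -/
theorem Real.prekopa_leindler {f g h : ℝ → ENNReal} {a b : ℝ} (ha : 0 < a) (hb : 0 < b)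
    (hab : a + b = 1) (mf : Measurable f) (mg : Measurable g) (mh : Measurable h)
    (H : ∀ x y, f x ^ a * g y ^ b ≤ h (a * x + b * y)) :
    (∫⁻ x, f x) ^ a * (∫⁻ x, g x) ^ b ≤ ∫⁻ x, h x := by
  have hfin : ∀ (k : ℝ → ENNReal) (n : ℕ), ⨆ x, min (k x) n ≠ ⊤ := fun k n =>
    ne_top_of_le_ne_top (ENNReal.natCast_ne_top n) (iSup_le fun x => min_le_right _ _)
  rw [lintegral_eq_iSup_lintegral_min_natCast mf, lintegral_eq_iSup_lintegral_min_natCast mg,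
    ENNReal.iSup_rpow_of_pos _ ha, ENNReal.iSup_rpow_of_pos _ hb]
  simp_rw [ENNReal.iSup_mul, ENNReal.mul_iSup]
  refine iSup_le fun m => iSup_le fun n => ?_
  refine Real.prekopa_leindler_of_bounded ha hb hab (mf.min measurable_const)
    (mg.min measurable_const) mh (hfin f m) (hfin g n) fun x y => le_trans ?_ (H x y)
  gcongr <;> exact min_le_left _ _

theorem measurable_fin_cons {n : ℕ} :
    Measurable (fun p : ℝ × (Fin n → ℝ) => (Fin.cons p.1 p.2 : Fin (n + 1) → ℝ)) := by
  refine measurable_pi_lambda _ fun i => ?_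
  refine Fin.cases ?_ (fun j => ?_) i
  · simpa using measurable_fst
  · simp only [Fin.cons_succ]
    exact (measurable_pi_apply j).comp measurable_snd

theorem MeasureTheory.lintegral_fin_succ_pi {n : ℕ} {f : (Fin (n + 1) → ℝ) → ENNReal}
    (mf : Measurable f) :
    ∫⁻ w, f w = ∫⁻ x : ℝ, ∫⁻ y : Fin n → ℝ, f (Fin.cons x y) := by
  have hmp := (volume_preserving_piFinSuccAbove (fun _ : Fin (n + 1) => ℝ) 0).symm
  rw [← hmp.lintegral_comp mf]
  refine (lintegral_prod _ (mf.comp hmp.measurable).aemeasurable).trans ?_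
  refine lintegral_congr fun x => lintegral_congr fun y => ?_
  simp [Fin.consEquiv]

/-- The Prékopa–Leindler inequality. -/
theorem prekopa_leindler {n : ℕ} {f g h : (Fin n → ℝ) → ENNReal} {a b : ℝ} (ha : 0 < a)
    (hb : 0 < b) (hab : a + b = 1) (mf : Measurable f) (mg : Measurable g) (mh : Measurable h)
    (H : ∀ x y, f x ^ a * g y ^ b ≤ h (a • x + b • y)) :
    (∫⁻ x, f x) ^ a * (∫⁻ x, g x) ^ b ≤ ∫⁻ x, h x := by
  induction n with
  | zero =>
    simp only [lintegral_unique, volume_pi, Measure.pi_empty_univ, mul_one]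
    convert H default default
  | succ n ih =>
    rw [lintegral_fin_succ_pi mf, lintegral_fin_succ_pi mg, lintegral_fin_succ_pi mh]
    have mcons : ∀ x : ℝ, Measurable (fun y : Fin n → ℝ => (Fin.cons x y : Fin (n + 1) → ℝ)) :=
      fun x => measurable_fin_cons.comp measurable_prodMk_left
    -- The one-dimensional inequality is applied to the integrals over the last `n` coordinates; its
    -- pointwise hypothesis is the induction hypothesis on slices.
    refine Real.prekopa_leindler ha hb hab (mf.comp measurable_fin_cons).lintegral_prod_right'
      (mg.comp measurable_fin_cons).lintegral_prod_right'
      (mh.comp measurable_fin_cons).lintegral_prod_right' fun x y => ?_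
    refine ih (mf.comp (mcons x)) (mg.comp (mcons y)) (mh.comp (mcons _)) fun u v => ?_
    refine (H _ _).trans_eq ?_
    congr 1
    ext i
    refine Fin.cases ?_ (fun j => ?_) i <;> simp

/-! ### Calculus of log-concave functions -/

namespace LogConcave

variable {E F : Type*} [AddCommGroup E] [Module ℝ E] [AddCommGroup F] [Module ℝ F]

theorem mul {f g : E → ℝ} (hf : LogConcave f) (hg : LogConcave g) :
    LogConcave (fun x => f x * g x) := by
  refine ⟨fun x => mul_nonneg (hf.1 x) (hg.1 x), fun x y a b ha hb hab => ?_⟩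
  rw [Real.mul_rpow (hf.1 x) (hg.1 x), Real.mul_rpow (hf.1 y) (hg.1 y), mul_mul_mul_comm]
  have := hf.1 x; have := hf.1 y; have := hg.1 x; have := hg.1 y
  exact mul_le_mul (hf.2 x y a b ha hb hab) (hg.2 x y a b ha hb hab) (by positivity) (hf.1 _)

theorem one : LogConcave (fun _ : E => (1 : ℝ)) :=
  ⟨fun _ => zero_le_one, fun x y a b _ _ _ => by simp⟩

theorem prod {ι : Type*} (s : Finset ι) {f : ι → E → ℝ} (hf : ∀ i ∈ s, LogConcave (f i)) :
    LogConcave (fun x => ∏ i ∈ s, f i x) := by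
  classical
  induction s using Finset.induction_on with
  | empty => simpa using one
  | insert i s hi ih =>
    simp_rw [Finset.prod_insert hi]
    exact (hf i (by simp)).mul (ih fun j hj => hf j (by simp [hj]))

theorem comp_linearMap {f : F → ℝ} (hf : LogConcave f) (A : E →ₗ[ℝ] F) :
    LogConcave (fun x => f (A x)) :=
  ⟨fun x => hf.1 _, fun x y a b ha hb hab => by
    simpa using hf.2 (A x) (A y) a b ha hb hab⟩

theorem exp_of_concaveOn {φ : E → ℝ} (hφ : ConcaveOn ℝ Set.univ φ) :
    LogConcave (fun x => Real.exp (φ x)) := by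
  refine ⟨fun x => (Real.exp_pos _).le, fun x y a b ha hb hab => ?_⟩
  rw [← Real.exp_mul, ← Real.exp_mul, ← Real.exp_add, Real.exp_le_exp]
  have := hφ.2 (Set.mem_univ x) (Set.mem_univ y) ha.le hb.le hab
  simp only [smul_eq_mul] at this
  linarith

theorem indicator {f : E → ℝ} (hf : LogConcave f) {C : Set E} (hC : Convex ℝ C) :
    LogConcave (C.indicator f) := by
  classical
  have h0 : ∀ x, 0 ≤ C.indicator f x := Set.indicator_nonneg fun x _ => hf.1 x
  refine ⟨h0, fun x y a b ha hb hab => ?_⟩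
  by_cases hx : x ∈ C
  · by_cases hy : y ∈ C
    · rw [Set.indicator_of_mem hx, Set.indicator_of_mem hy,
        Set.indicator_of_mem (hC hx hy ha.le hb.le hab)]
      exact hf.2 x y a b ha hb hab
    · rw [Set.indicator_of_notMem hy, Real.zero_rpow hb.ne', mul_zero]
      exact h0 _
  · rw [Set.indicator_of_notMem hx, Real.zero_rpow ha.ne', zero_mul]
    exact h0 _

/-- Prékopa's theorem: marginals of log-concave functions are log-concave. -/
theorem lintegral_toReal {n : ℕ} {k : E × (Fin n → ℝ) → ℝ} (hk : LogConcave k)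
    (mk : ∀ x, Measurable fun w => k (x, w))
    (fin : ∀ x, ∫⁻ w, ENNReal.ofReal (k (x, w)) ≠ ⊤) :
    LogConcave (fun x => (∫⁻ w, ENNReal.ofReal (k (x, w))).toReal) := by
  refine ⟨fun x => ENNReal.toReal_nonneg, fun x y a b ha hb hab => ?_⟩
  rw [ENNReal.toReal_rpow, ENNReal.toReal_rpow, ← ENNReal.toReal_mul]
  refine ENNReal.toReal_mono (fin _) ?_
  refine prekopa_leindler ha hb hab (mk x).ennreal_ofReal (mk y).ennreal_ofReal
    (mk _).ennreal_ofReal fun u v => ?_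
  rw [ENNReal.ofReal_rpow_of_nonneg (hk.1 _) ha.le, ENNReal.ofReal_rpow_of_nonneg (hk.1 _) hb.le,
    ← ENNReal.ofReal_mul (Real.rpow_nonneg (hk.1 _) _)]
  exact ENNReal.ofReal_le_ofReal (hk.2 (x, u) (y, v) a b ha hb hab)

/-- Quasi-concavity: a weighted geometric mean dominates the minimum. This handles the strict outage
constraint. -/
theorem min_le {f : E → ℝ} (hf : LogConcave f) {x y : E} {a b : ℝ} (ha : 0 < a) (hb : 0 < b)
    (hab : a + b = 1) : min (f x) (f y) ≤ f (a • x + b • y) := by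
  refine le_trans ?_ (hf.2 x y a b ha hb hab)
  have h0 : 0 ≤ min (f x) (f y) := le_min (hf.1 x) (hf.1 y)
  calc min (f x) (f y) = min (f x) (f y) ^ a * min (f x) (f y) ^ b := by
        rw [← Real.rpow_add_of_nonneg h0 ha.le hb.le, hab, Real.rpow_one]
    _ ≤ f x ^ a * f y ^ b := by
        have := hf.1 x
        gcongr
        · exact min_le_left _ _
        · exact min_le_right _ _

end LogConcave

/-! ### Logarithmic coordinates and sums of exponentials -/

theorem Set.image_exp_pi_univ (ι : Type*) :
    (fun (w : ι → ℝ) j => Real.exp (w j)) '' Set.univ = {w | ∀ j, 0 < w j} := by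
  ext w
  simp only [Set.image_univ, Set.mem_range, Set.mem_ofPred_eq]
  constructor
  · rintro ⟨v, rfl⟩ j
    exact Real.exp_pos _
  · intro h
    exact ⟨fun j => Real.log (w j), funext fun j => Real.exp_log (h j)⟩

/-- Integration over the positive orthant in logarithmic coordinates. -/
theorem MeasureTheory.setLIntegral_pos_orthant {n : ℕ} (g : (Fin n → ℝ) → ENNReal) :
    ∫⁻ w in {w : Fin n → ℝ | ∀ j, 0 < w j}, g w =
      ∫⁻ w : Fin n → ℝ, ENNReal.ofReal (Real.exp (∑ j, w j)) * g (fun j => Real.exp (w j)) := by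
  rw [← Set.image_exp_pi_univ]
  have hder : ∀ w ∈ (Set.univ : Set (Fin n → ℝ)),
      HasFDerivWithinAt (fun (w : Fin n → ℝ) j => Real.exp (w j))
        (ContinuousLinearMap.pi fun j => (ContinuousLinearMap.toSpanSingleton ℝ
          (Real.exp (w j))).comp (ContinuousLinearMap.proj j)) Set.univ w := by
    intro w _
    refine HasFDerivAt.hasFDerivWithinAt (hasFDerivAt_pi.2 fun j => ?_)
    exact (Real.hasDerivAt_exp (w j)).hasFDerivAt.comp w
      (ContinuousLinearMap.proj (R := ℝ) (φ := fun _ : Fin n => ℝ) j).hasFDerivAt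
  rw [lintegral_image_eq_lintegral_abs_det_fderiv_mul volume MeasurableSet.univ hder]
  · simp only [Measure.restrict_univ]
    refine lintegral_congr fun w => ?_
    rw [ContinuousLinearMap.det_pi]
    simp only [ContinuousLinearMap.det_toSpanSingleton]
    rw [← Real.exp_sum, abs_of_pos (Real.exp_pos _)]
  · intro u _ v _ huv
    ext j
    exact Real.exp_injective (congrFun huv j)

theorem ConvexOn.finset_sum {E ι : Type*} [AddCommGroup E] [Module ℝ E] {D : Set E}
    (hD : Convex ℝ D) (s : Finset ι) {φ : ι → E → ℝ} (h : ∀ i ∈ s, ConvexOn ℝ D (φ i)) :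
    ConvexOn ℝ D (fun x => ∑ i ∈ s, φ i x) := by
  classical
  induction s using Finset.induction_on with
  | empty => simpa using convexOn_const 0 hD
  | insert i s hi ih =>
    simp_rw [Finset.sum_insert hi]
    exact (h i (by simp)).add (ih fun j hj => h j (by simp [hj]))

theorem convexOn_exp_affine {E : Type*} [AddCommGroup E] [Module ℝ E] (A : E →ₗ[ℝ] ℝ) (c : ℝ) :
    ConvexOn ℝ Set.univ (fun x => Real.exp (A x + c)) := by
  refine ⟨convex_univ, fun x _ y _ a b ha hb hab => ?_⟩
  refine le_trans (le_of_eq ?_)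
    (convexOn_exp.2 (Set.mem_univ (A x + c)) (Set.mem_univ (A y + c)) ha hb hab)
  refine congrArg Real.exp ?_
  simp only [map_add, map_smul, smul_eq_mul]
  linear_combination (-c) * hab

/-! ### Log-concavity of the reliability function -/

section Reliability

variable {M : ℕ} {N : Fin M → ℝ}

theorem interference_pos (hN : ∀ i, 0 < N i) (i : Fin M) {w P : Fin M → ℝ} (hw : ∀ j, 0 ≤ w j)
    (hP : ∀ j, 0 ≤ P j) : 0 < N i + ∑ j ∈ Finset.univ.erase i, P j * w j :=
  add_pos_of_pos_of_nonneg (hN i) (Finset.sum_nonneg fun j _ => mul_nonneg (hP j) (hw j))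

theorem exp_lt_sinr_iff (hN : ∀ i, 0 < N i) (i : Fin M) {w : Fin M → ℝ} (hw : ∀ j, 0 < w j)
    (S : ℝ) (P : Fin M → ℝ) :
    Real.exp S < sinr N i w (fun j => Real.exp (P j)) ↔
      Real.exp (S - P i + Real.log (N i)) +
        ∑ j ∈ Finset.univ.erase i, Real.exp (S - P i + P j + Real.log (w j)) < w i := by
  have hD := interference_pos hN i (fun j => (hw j).le) (fun j => (Real.exp_pos (P j)).le)
  rw [sinr, lt_div_iff₀ hD]
  have e : Real.exp (S - P i + Real.log (N i)) +
        ∑ j ∈ Finset.univ.erase i, Real.exp (S - P i + P j + Real.log (w j)) =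
      Real.exp S * (N i + ∑ j ∈ Finset.univ.erase i, Real.exp (P j) * w j) / Real.exp (P i) := by
    simp_rw [Real.exp_add, Real.exp_sub, Real.exp_log (hw _), Real.exp_log (hN _)]
    rw [mul_add, Finset.mul_sum, add_div, Finset.sum_div]
    congr 1
    · ring
    · exact Finset.sum_congr rfl fun j _ => by ring
  rw [e, div_lt_iff₀ (Real.exp_pos _), mul_comm (w i)]

/-- In logarithmic variables, the target SINR is exceeded on a convex set. -/
theorem convex_exp_lt_sinr (hN : ∀ i, 0 < N i) (i : Fin M) :
    Convex ℝ {p : (ℝ × (Fin M → ℝ)) × (Fin M → ℝ) |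
      Real.exp p.1.1 < sinr N i (fun j => Real.exp (p.2 j)) (fun j => Real.exp (p.1.2 j))} := by
  let s : (ℝ × (Fin M → ℝ)) × (Fin M → ℝ) →ₗ[ℝ] ℝ := LinearMap.fst ℝ _ _ ∘ₗ LinearMap.fst ℝ _ _
  let P : Fin M → (ℝ × (Fin M → ℝ)) × (Fin M → ℝ) →ₗ[ℝ] ℝ := fun j =>
    LinearMap.proj j ∘ₗ LinearMap.snd ℝ _ _ ∘ₗ LinearMap.fst ℝ _ _
  let v : Fin M → (ℝ × (Fin M → ℝ)) × (Fin M → ℝ) →ₗ[ℝ] ℝ := fun j =>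
    LinearMap.proj j ∘ₗ LinearMap.snd ℝ _ _
  -- Dividing by the gain `exp (v i)` moves it into the exponents, leaving the strict sublevel set
  -- at 1 of a convex function.
  have hc := ((convexOn_exp_affine (s - P i - v i) (Real.log (N i))).add
    (ConvexOn.finset_sum convex_univ (Finset.univ.erase i) fun j _ =>
      convexOn_exp_affine (s - P i + P j + v j - v i) 0)).convex_lt 1
  refine (congrArg (Convex ℝ) (Set.ext fun p => ?_)).mpr hc
  simp only [Set.mem_ofPred_eq, Set.mem_univ, true_and, Pi.add_apply]
  rw [exp_lt_sinr_iff hN i (fun j => Real.exp_pos _), ← div_lt_one (Real.exp_pos (p.2 i)),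
    add_div, Finset.sum_div]
  simp only [← Real.exp_sub, Real.log_exp]
  refine iff_of_eq (congrArg (· < (1 : ℝ)) (congrArg₂ _ ?_ (Finset.sum_congr rfl fun j _ => ?_)))
  · congr 1
    simp [s, P, v]
    ring
  · simp [s, P, v]

theorem measurable_sinr (N : Fin M → ℝ) (i : Fin M) (P : Fin M → ℝ) :
    Measurable fun w => sinr N i w P := by
  unfold sinr
  fun_prop

theorem compl_outageEvent {Ω : Type*} (W : Fin M → Fin M → Ω → ℝ) (N : Fin M → ℝ) (i : Fin M) (s : ℝ) (P : Fin M → ℝ) :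
    (outageEvent W N i s P)ᶜ = {ω | s < sinr N i (fun j => W i j ω) P} := by
  ext ω
  simp [outageEvent]

variable {Ω : Type*} [MeasurableSpace Ω] {μ : Measure Ω} {W : Fin M → Fin M → Ω → ℝ}

/-- Coordinate hyperplanes are Lebesgue null, so a density excludes zero gains and logarithms may be
taken almost surely. -/
theorem HasDensity.ae_pos {X : Fin M → Ω → ℝ} (hX : ∀ j, Measurable (X j))
    (hX0 : ∀ j, ∀ᵐ ω ∂μ, 0 ≤ X j ω) {f : (Fin M → ℝ) → ℝ}
    (hf : HasDensity μ (fun ω j => X j ω) f) : ∀ᵐ ω ∂μ, ∀ j, 0 < X j ω := by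
  have mX : Measurable fun ω j => X j ω := measurable_pi_lambda _ hX
  rw [ae_all_iff]
  intro j
  have h0 : ∀ᵐ w ∂(μ.map fun ω j => X j ω), w j ≠ 0 := by
    rw [hf.2.2]
    refine (withDensity_absolutelyContinuous _ _).ae_le ?_
    exact compl_mem_ae_iff.2 (Measure.pi_hyperplane (fun _ : Fin M => (volume : Measure ℝ)) j 0)
  filter_upwards [hX0 j, ae_of_ae_map mX.aemeasurable h0] with ω h1 h2
  exact lt_of_le_of_ne h1 (Ne.symm h2)

theorem reliability_eq_lintegral (hW : ∀ i j, Measurable (W i j))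
    (hW0 : ∀ i j, ∀ᵐ ω ∂μ, 0 ≤ W i j ω) (i : Fin M) {f : (Fin M → ℝ) → ℝ}
    (hf : HasDensity μ (fun ω j => W i j ω) f) (x : ℝ × (Fin M → ℝ)) :
    μ (outageEvent W N i (Real.exp x.1) (fun j => Real.exp (x.2 j)))ᶜ =
      ∫⁻ v, ENNReal.ofReal ({p : (ℝ × (Fin M → ℝ)) × (Fin M → ℝ) |
        Real.exp p.1.1 < sinr N i (fun j => Real.exp (p.2 j))
          (fun j => Real.exp (p.1.2 j))}.indicator
          (fun p => f (fun j => Real.exp (p.2 j)) * Real.exp (∑ j, p.2 j)) (x, v)) := by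
  have mX : Measurable fun ω j => W i j ω := measurable_pi_lambda _ (hW i)
  set A : Set (Fin M → ℝ) := {w | Real.exp x.1 < sinr N i w fun j => Real.exp (x.2 j)} with hA
  have mA : MeasurableSet A := measurableSet_lt measurable_const (measurable_sinr _ _ _)
  set O : Set (Fin M → ℝ) := {w | ∀ j, 0 < w j} with hO
  have mO : MeasurableSet O := by
    simp only [hO, Set.ofPred_forall]
    exact MeasurableSet.iInter fun j => measurableSet_lt measurable_const (measurable_pi_apply j)
  have hpos := hf.ae_pos (hW i) (hW0 i)
  have h1 : μ (outageEvent W N i (Real.exp x.1) (fun j => Real.exp (x.2 j)))ᶜ =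
      (μ.map fun ω j => W i j ω) (O ∩ A) := by
    rw [Measure.map_apply mX (mO.inter mA), compl_outageEvent]
    refine measure_congr ?_
    filter_upwards [hpos] with ω hω
    exact propext ⟨fun h => ⟨hω, h⟩, fun h => h.2⟩
  rw [h1, hf.2.2, withDensity_apply _ (mO.inter mA), Set.inter_comm,
    ← Measure.restrict_restrict mA, ← lintegral_indicator mA, setLIntegral_pos_orthant]
  refine lintegral_congr fun v => ?_
  by_cases hv : (fun j => Real.exp (v j)) ∈ A
  · rw [Set.indicator_of_mem hv, Set.indicator_of_mem (by exact hv), mul_comm,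
      ENNReal.ofReal_mul (hf.2.1 _)]
  · rw [Set.indicator_of_notMem hv, Set.indicator_of_notMem (by exact hv)]
    simp

theorem logConcave_reliability [IsFiniteMeasure μ] (hW : ∀ i j, Measurable (W i j))
    (hW0 : ∀ i j, ∀ᵐ ω ∂μ, 0 ≤ W i j ω) (hN : ∀ i, 0 < N i) (i : Fin M)
    {f : (Fin M → ℝ) → ℝ} (hf : HasDensity μ (fun ω j => W i j ω) f)
    (hlc : LogConcave fun w : Fin M → ℝ => f fun j => Real.exp (w j)) :
    LogConcave (fun x : ℝ × (Fin M → ℝ) => reliability μ W N i x.1 x.2) := by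
  simp only [reliability, Measure.real, reliability_eq_lintegral hW hW0 i hf]
  have hsum : ConcaveOn ℝ Set.univ fun w : Fin M → ℝ => ∑ j, w j := by
    refine ⟨convex_univ, fun x _ y _ a b _ _ _ => le_of_eq ?_⟩
    simp [Finset.sum_add_distrib, Finset.mul_sum]
  refine LogConcave.lintegral_toReal (E := ℝ × (Fin M → ℝ)) (LogConcave.indicator ?_
    (convex_exp_lt_sinr hN i)) (fun x => ?_) (fun x => ?_)
  · exact (hlc.mul (LogConcave.exp_of_concaveOn hsum)).comp_linearMap
      (LinearMap.snd ℝ (ℝ × (Fin M → ℝ)) (Fin M → ℝ))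
  · have mexp : Measurable fun (v : Fin M → ℝ) j => Real.exp (v j) := by fun_prop
    have mset : MeasurableSet {v : Fin M → ℝ |
        Real.exp x.1 < sinr N i (fun j => Real.exp (v j)) (fun j => Real.exp (x.2 j))} :=
      measurableSet_lt measurable_const ((measurable_sinr N i fun j => Real.exp (x.2 j)).comp mexp)
    have mf : Measurable fun v : Fin M → ℝ =>
        f (fun j => Real.exp (v j)) * Real.exp (∑ j, v j) :=
      (hf.1.comp mexp).mul (by fun_prop)
    exact mf.indicator mset
  · rw [← reliability_eq_lintegral hW hW0 i hf]
    exact measure_ne_top _ _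

theorem reliability_eq_measureReal_log (hW : ∀ i j, Measurable (W i j))
    (hW0 : ∀ i j, ∀ᵐ ω ∂μ, 0 ≤ W i j ω) (hN : ∀ i, 0 < N i) (i : Fin M)
    {f : (Fin M → ℝ) → ℝ} (hf : HasDensity μ (fun ω j => W i j ω) f) (S : ℝ) (P : Fin M → ℝ) :
    reliability μ W N i S P =
        μ.real {ω | Real.log (W i i ω) >
          Real.log (Real.exp (S - P i + Real.log (N i)) +
            ∑ j ∈ Finset.univ.erase i, Real.exp (S - P i + P j + Real.log (W i j ω)))} := by
  rw [reliability, compl_outageEvent]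
  refine measureReal_congr ?_
  filter_upwards [hf.ae_pos (hW i) (hW0 i)] with ω hω
  refine propext ?_
  change _ < _ ↔ _ < _
  rw [exp_lt_sinr_iff hN i hω, Real.log_lt_log_iff _ (hω i)]
  exact add_pos_of_pos_of_nonneg (Real.exp_pos _)
    (Finset.sum_nonneg fun j _ => (Real.exp_pos _).le)

end Reliability

/-! ### Convexity of the constraints and of the program -/

/-- The reciprocal of the rate `log (1 + exp s)` is convex. -/
theorem convexOn_inv_log_one_add_exp :
    ConvexOn ℝ Set.univ fun s : ℝ => (Real.log (1 + Real.exp s))⁻¹ := by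
  have hpos : ∀ s : ℝ, 0 < Real.log (1 + Real.exp s) := fun s =>
    Real.log_pos (by linarith [Real.exp_pos s])
  have hder : ∀ s : ℝ, HasDerivAt (fun s : ℝ => (Real.log (1 + Real.exp s))⁻¹)
      (-(Real.exp s / (1 + Real.exp s)) / Real.log (1 + Real.exp s) ^ 2) s := fun s =>
    (((Real.hasDerivAt_exp s).const_add 1).log
      (by linarith [Real.exp_pos s] : (0 : ℝ) < 1 + Real.exp s).ne').fun_inv (hpos s).ne'
  refine Monotone.convexOn_univ_of_deriv (fun s => (hder s).differentiableAt) ?_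
  rw [funext fun s => (hder s).deriv]
  intro s t hst
  -- In terms of `u = log (1 + exp s)` the derivative is `-(1 - exp (-u)) / u ^ 2`, so it suffices
  -- that `(1 - exp (-u)) / u ^ 2` decreases for `u > 0`.
  have hexp : ∀ s : ℝ, Real.exp s / (1 + Real.exp s) = 1 - Real.exp (-Real.log (1 + Real.exp s)) := by
    intro s
    have := Real.exp_pos s
    rw [Real.exp_neg, Real.exp_log (by positivity)]
    field_simp
    ring
  have huv : Real.log (1 + Real.exp s) ≤ Real.log (1 + Real.exp t) :=
    Real.log_le_log (by positivity) (by gcongr)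
  simp only [hexp, neg_div, neg_le_neg_iff]
  have hu := hpos s
  have hv := hpos t
  set u := Real.log (1 + Real.exp s)
  set v := Real.log (1 + Real.exp t)
  rw [div_le_div_iff₀ (by positivity) (by positivity)]
  -- Since `-u` lies between `-v` and `0`, convexity of `exp` gives `u * (1 - exp (-v)) ≤ v * (1 -
  -- exp (-u))`. Multiplying by `u` and using `u ≤ v` finishes.
  have hconv := convexOn_exp.2 (Set.mem_univ (-v)) (Set.mem_univ (0 : ℝ))
    (div_nonneg hu.le hv.le) (sub_nonneg.2 ((div_le_one hv).2 huv)) (by ring)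
  simp only [smul_eq_mul, Real.exp_zero, mul_zero, add_zero] at hconv
  rw [show u / v * -v = -u by field_simp] at hconv
  have h1 : v * Real.exp (-u) ≤ u * Real.exp (-v) + v - u := by
    calc v * Real.exp (-u) ≤ v * (u / v * Real.exp (-v) + (1 - u / v) * 1) := by gcongr
      _ = u * Real.exp (-v) + v - u := by field_simp; ring
  have h2 : 0 ≤ 1 - Real.exp (-u) := by
    rw [sub_nonneg, Real.exp_le_one_iff]; linarith
  nlinarith [mul_le_mul_of_nonneg_left (show u * (1 - Real.exp (-v)) ≤ v * (1 - Real.exp (-u)) by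
    linarith) hu.le, mul_nonneg (mul_nonneg hv.le h2) (sub_nonneg.2 huv)]

theorem convexOn_packet_div_rate {L : ℝ} (hL : 0 ≤ L) :
    ConvexOn ℝ Set.univ fun s : ℝ => L / Real.logb 2 (1 + Real.exp s) := by
  refine ((convexOn_inv_log_one_add_exp.smul
    (mul_nonneg hL (Real.log_nonneg one_le_two)))).congr fun s _ => ?_
  simp [Real.logb, div_eq_mul_inv, mul_assoc]

theorem extLn_le_extLn {x y : ℝ} (hy : 0 ≤ y) : extLn x ≤ extLn y ↔ x ≤ y := by
  rw [extLn, extLn, ENNReal.log_le_log_iff, ENNReal.ofReal_le_ofReal_iff hy]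

theorem extLn_exp (t : ℝ) : extLn (Real.exp t) = t := by
  rw [extLn, ENNReal.log_ofReal_of_pos (Real.exp_pos t), Real.log_exp]

theorem neg_extLn_le_coe {x t : ℝ} (hx : 0 ≤ x) : -extLn x ≤ (t : EReal) ↔ Real.exp (-t) ≤ x := by
  rw [EReal.neg_le, ← EReal.coe_neg, ← extLn_exp, extLn_le_extLn hx]

theorem ExtConvexOn.of_convexOn {E : Type*} [AddCommGroup E] [Module ℝ E] {D : Set E} {f : E → ℝ}
    (hf : ConvexOn ℝ D f) : ExtConvexOn D fun x => (f x : EReal) := by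
  unfold ExtConvexOn
  simpa only [EReal.coe_le_coe_iff] using hf.convex_epigraph

/-- The epigraph condition `-ln f x ≤ t` is `exp (-t) ≤ f x`, which passes to weighted geometric
means. No `EReal` arithmetic is needed where `f` vanishes. -/
theorem LogConcave.extConvexOn_neg_extLn {E : Type*} [AddCommGroup E] [Module ℝ E] {D : Set E}
    (hD : Convex ℝ D) {f : E → ℝ} (hf : LogConcave f) : ExtConvexOn D fun x => -extLn (f x) := by
  unfold ExtConvexOn
  simp only [neg_extLn_le_coe (hf.1 _)]
  rw [convex_iff_forall_pos]
  rintro ⟨x, s⟩ ⟨hx, hxs⟩ ⟨y, t⟩ ⟨hy, hyt⟩ a b ha hb hab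
  refine ⟨hD hx hy ha.le hb.le hab, le_trans ?_ (hf.2 x y a b ha hb hab)⟩
  have := hf.1 x
  calc Real.exp (-(a • s + b • t)) = Real.exp (-s) ^ a * Real.exp (-t) ^ b := by
        rw [← Real.exp_mul, ← Real.exp_mul, ← Real.exp_add]
        congr 1
        simp only [smul_eq_mul]
        ring
    _ ≤ f x ^ a * f y ^ b := by
        have h1 : Real.exp (-s) ≤ f x := hxs
        have h2 : Real.exp (-t) ≤ f y := hyt
        gcongr

theorem ConvexOn.comp_linearMap_of_mapsTo {E F : Type*} [AddCommGroup E] [Module ℝ E]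
    [AddCommGroup F] [Module ℝ F] {D : Set E} {C : Set F} (hD : Convex ℝ D) {f : F → ℝ}
    (hf : ConvexOn ℝ C f) (A : E →ₗ[ℝ] F) (h : Set.MapsTo A D C) :
    ConvexOn ℝ D fun x => f (A x) :=
  (hf.comp_linearMap A).subset h hD

section Network

variable {Ω : Type*} [MeasurableSpace Ω] {μ : Measure Ω} [IsProbabilityMeasure μ]
  {M : ℕ} {W : Fin M → Fin M → Ω → ℝ} {N L Pbar q : Fin M → ℝ}

theorem measureReal_outageEvent (hW : ∀ i j, Measurable (W i j)) (N : Fin M → ℝ) (i : Fin M)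
    (S : ℝ) (P : Fin M → ℝ) :
    μ.real (outageEvent W N i (Real.exp S) (fun j => Real.exp (P j))) =
      1 - reliability μ W N i S P := by
  have hm : MeasurableSet (outageEvent W N i (Real.exp S) (fun j => Real.exp (P j))) :=
    measurableSet_le ((measurable_sinr N i fun j => Real.exp (P j)).comp
      (measurable_pi_lambda _ (hW i))) measurable_const
  rw [reliability, probReal_compl_eq_one_sub hm]
  ring

theorem convex_posTime : Convex ℝ {x : (Fin M → ℝ) × (Fin M → ℝ) × (Fin M → ℝ) |
    ∀ i, 0 < x.1 i} := by
  intro x hx y hy a b ha hb hab i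
  have h := (convex_Ioi (0 : ℝ)) (hx i) (hy i) ha hb hab
  simpa using h

theorem posedAsConvexProgram_of_logConcave (hW : ∀ i j, Measurable (W i j))
    (hrel : ∀ i, LogConcave fun x : ℝ × (Fin M → ℝ) => reliability μ W N i x.1 x.2)
    {J : (Fin M → ℝ) → ℝ} (hL : ∀ i, 0 < L i) (hP : ∀ i, 0 < Pbar i)
    (hJ : ConvexOn ℝ {T : Fin M → ℝ | ∀ i, 0 < T i} J) :
    PosedAsConvexProgram μ W N L Pbar q J := by
  let E := (Fin M → ℝ) × (Fin M → ℝ) × (Fin M → ℝ)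
  let proj : Fin M → (Fin M → ℝ) →ₗ[ℝ] ℝ := fun i => LinearMap.proj i
  let T : E →ₗ[ℝ] (Fin M → ℝ) := LinearMap.fst ℝ _ _
  let S : E →ₗ[ℝ] (Fin M → ℝ) := LinearMap.fst ℝ _ _ ∘ₗ LinearMap.snd ℝ _ _
  let P : E →ₗ[ℝ] (Fin M → ℝ) := LinearMap.snd ℝ _ _ ∘ₗ LinearMap.snd ℝ _ _
  have htime : ∀ i, ConvexOn ℝ Set.univ fun x : (Fin M → ℝ) × (Fin M → ℝ) × (Fin M → ℝ) =>
      L i / Real.logb 2 (1 + Real.exp (x.2.1 i)) - x.1 i := fun i => by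
    have h1 : ConvexOn ℝ Set.univ fun x : E => L i / Real.logb 2 (1 + Real.exp (x.2.1 i)) :=
      (convexOn_packet_div_rate (hL i).le).comp_linearMap_of_mapsTo convex_univ (proj i ∘ₗ S)
        (Set.mapsTo_univ _ _)
    exact h1.sub ((proj i ∘ₗ T).concaveOn convex_univ)
  have hrate : ∀ s : ℝ, 0 < Real.logb 2 (1 + Real.exp s) := fun s =>
    Real.logb_pos one_lt_two (by linarith [Real.exp_pos s])
  have hlc : ∀ i, LogConcave fun x : (Fin M → ℝ) × (Fin M → ℝ) × (Fin M → ℝ) =>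
      reliability μ W N i (x.2.1 i) x.2.2 := fun i =>
    (hrel i).comp_linearMap ((proj i ∘ₗ S).prod P)
  refine ⟨⟨?_, ?_⟩, ?_, ?_⟩
  · exact hJ.comp_linearMap_of_mapsTo convex_posTime T fun x hx => hx
  · rintro (i | i | i)
    · exact .of_convexOn ((htime i).subset (Set.subset_univ _) convex_posTime)
    · exact (hlc i).extConvexOn_neg_extLn convex_posTime
    · exact .of_convexOn ((proj i ∘ₗ P).convexOn convex_posTime)
  · intro T S P
    simp only [OutageFeasible, OptProgram.feasibleSet, outageProgram, Set.mem_ofPred_eq, Sum.forall,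
      EReal.neg_le_neg_iff, EReal.coe_le_coe_iff, ← EReal.coe_zero, sub_nonpos, Real.exp_pos,
      (Real.exp_pos _).le, true_and, measureReal_outageEvent hW]
    simp only [extLn_le_extLn ((hrel _).1 (S _, P)),
      Real.le_log_iff_exp_le (hP _)]
    -- Positivity of the completion times, part of the program's domain, follows from the time
    -- constraint because packet lengths and rates are positive.
    constructor
    · intro h
      exact ⟨fun i => (div_pos (hL i) (hrate _)).trans_le (h i).1, fun i => (h i).1,
        fun i => by linarith [(h i).2.1], fun i => (h i).2.2⟩
    · rintro ⟨-, h1, h2, h3⟩ i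
      exact ⟨h1 i, by linarith [h2 i], h3 i⟩
  · rw [convex_iff_forall_pos]
    intro x hx y hy a b ha hb hab i
    obtain ⟨-, hx1, hx2, -, hx3⟩ := hx i
    obtain ⟨-, hy1, hy2, -, hy3⟩ := hy i
    simp only [measureReal_outageEvent hW] at hx2 hy2 ⊢
    refine ⟨Real.exp_pos _, ?_, ?_, (Real.exp_pos _).le, ?_⟩
    · have h := (htime i).convex_le 0 ⟨trivial, sub_nonpos.2 hx1⟩ ⟨trivial, sub_nonpos.2 hy1⟩
        ha.le hb.le hab
      exact sub_nonpos.1 h.2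
    · have h := (hlc i).min_le (x := x) (y := y) ha hb hab
      have h' : 1 - q i < min (reliability μ W N i (x.2.1 i) x.2.2)
        (reliability μ W N i (y.2.1 i) y.2.2) := lt_min (by linarith) (by linarith)
      linarith [h'.trans_le h]
    · rw [← Real.le_log_iff_exp_le (hP i)] at hx3 hy3 ⊢
      have h := (convex_Iic (Real.log (Pbar i))) hx3 hy3 ha.le hb.le hab
      exact h

end Network

/-! ### Product densities and the standard fading laws -/

theorem MeasureTheory.lintegral_pi_prod {n : ℕ} {k : Fin n → ℝ → ENNReal}
    (mk : ∀ j, Measurable (k j)) : ∫⁻ w : Fin n → ℝ, ∏ j, k j (w j) = ∏ j, ∫⁻ x, k j x := by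
  induction n with
  | zero => simp [lintegral_unique, volume_pi, Measure.pi_empty_univ]
  | succ n ih =>
    have hm : Measurable fun w : Fin (n + 1) → ℝ => ∏ j, k j (w j) :=
      Finset.measurable_prod _ fun j _ => (mk j).comp (measurable_pi_apply j)
    have hm' : Measurable fun w : Fin n → ℝ => ∏ j : Fin n, k j.succ (w j) :=
      Finset.measurable_prod _ fun j _ => (mk j.succ).comp (measurable_pi_apply j)
    rw [lintegral_fin_succ_pi hm, Fin.prod_univ_succ, ← ih fun j => mk j.succ,
      ← lintegral_mul_const _ (mk 0)]
    refine lintegral_congr fun x => ?_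
    rw [← lintegral_const_mul _ hm']
    exact lintegral_congr fun y => by simp [Fin.prod_univ_succ]

theorem MeasureTheory.Measure.pi_withDensity {n : ℕ} {k : Fin n → ℝ → ENNReal}
    (mk : ∀ j, Measurable (k j))
    [∀ j, SigmaFinite ((volume : Measure ℝ).withDensity (k j))] :
    Measure.pi (fun j => (volume : Measure ℝ).withDensity (k j)) =
      (volume : Measure (Fin n → ℝ)).withDensity (fun w => ∏ j, k j (w j)) := by
  refine Measure.pi_eq fun s hs => ?_
  rw [withDensity_apply _ (MeasurableSet.univ_pi hs),
    ← lintegral_indicator (MeasurableSet.univ_pi hs)]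
  simp_rw [withDensity_apply _ (hs _), ← lintegral_indicator (hs _)]
  rw [← lintegral_pi_prod fun j => (mk j).indicator (hs j)]
  refine lintegral_congr fun w => ?_
  classical
  by_cases hw : w ∈ Set.univ.pi s
  · rw [Set.indicator_of_mem hw]
    exact Finset.prod_congr rfl fun j _ => (Set.indicator_of_mem (hw j trivial) _).symm
  · rw [Set.indicator_of_notMem hw]
    simp only [Set.mem_pi, Set.mem_univ, forall_const, not_forall] at hw
    obtain ⟨j, hj⟩ := hw
    exact (Finset.prod_eq_zero (Finset.mem_univ j) (Set.indicator_of_notMem hj _)).symm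

/-- The density of the image of an absolutely continuous law under a differentiable injection. -/
theorem map_withDensity_of_hasDerivAt {D R : Set ℝ} (hD : MeasurableSet D) (hR : MeasurableSet R)
    {φ φ' g k : ℝ → ℝ} (mφ : Measurable φ) (hφ : ∀ t ∈ D, HasDerivAt φ (φ' t) t)
    (hinj : Set.InjOn φ D) (himg : φ '' D = R) (hk : ∀ t ∈ D, |φ' t| * k (φ t) = g t) :
    ((volume.restrict D).withDensity fun t => ENNReal.ofReal (g t)).map φ =
      volume.withDensity fun x => ENNReal.ofReal (R.indicator k x) := by
  ext s hs
  have hpre := mφ hs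
  have e1 : ∀ x, ENNReal.ofReal (R.indicator k x) = R.indicator (fun x => ENNReal.ofReal (k x)) x :=
    fun x => by by_cases hx : x ∈ R <;> simp [hx]
  rw [Measure.map_apply mφ hs, withDensity_apply _ hpre, withDensity_apply _ hs]
  simp_rw [e1]
  rw [← lintegral_indicator hs, ← lintegral_indicator hpre, Set.indicator_indicator, Set.inter_comm,
    ← Set.indicator_indicator, lintegral_indicator hR, ← himg,
    lintegral_image_eq_lintegral_abs_deriv_mul hD (fun t ht => (hφ t ht).hasDerivWithinAt) hinj]
  refine setLIntegral_congr_fun hD fun t ht => ?_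
  by_cases h : φ t ∈ s
  · simp only [Set.indicator_of_mem h, Set.indicator_of_mem (show t ∈ φ ⁻¹' s from h)]
    rw [← ENNReal.ofReal_mul (abs_nonneg _), hk t ht]
  · simp only [Set.indicator_of_notMem h, Set.indicator_of_notMem (show t ∉ φ ⁻¹' s from h),
      mul_zero]

/-- The law `ν` on the line has a density `k` such that `w ↦ k (exp w)` is log-concave. -/
def HasLogConcaveExpDensity (ν : Measure ℝ) : Prop :=
  ∃ k : ℝ → ℝ, Measurable k ∧ (∀ x, 0 ≤ k x) ∧ LogConcave (fun w => k (Real.exp w)) ∧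
    ν = volume.withDensity fun x => ENNReal.ofReal (k x)

/-- Only the values of the density on the positive half-line enter `w ↦ k (exp w)`, so cutting it
off elsewhere is harmless. -/
theorem hasLogConcaveExpDensity_of_exp {ν : Measure ℝ} {k φ : ℝ → ℝ} (mk : Measurable k)
    (hφ : ConcaveOn ℝ Set.univ φ) (hk : ∀ w, k (Real.exp w) = Real.exp (φ w))
    (hν : ν = volume.withDensity fun x => ENNReal.ofReal ((Set.Ioi 0).indicator k x)) :
    HasLogConcaveExpDensity ν := by
  refine ⟨(Set.Ioi 0).indicator k, mk.indicator measurableSet_Ioi,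
    Set.indicator_nonneg fun x hx => ?_, ?_, hν⟩
  · rw [← Real.exp_log hx, hk]
    exact (Real.exp_pos _).le
  · have : (fun w => (Set.Ioi (0 : ℝ)).indicator k (Real.exp w)) = fun w => Real.exp (φ w) := by
      funext w
      rw [Set.indicator_of_mem (Set.mem_Ioi.2 (Real.exp_pos w)), hk]
    rw [this]
    exact .exp_of_concaveOn hφ

theorem Set.image_sq_Ioi_zero : (fun t : ℝ => t ^ 2) '' Set.Ioi 0 = Set.Ioi 0 := by
  ext x
  constructor
  · rintro ⟨t, ht, rfl⟩
    exact pow_pos (Set.mem_Ioi.1 ht) 2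
  · intro hx
    exact ⟨Real.sqrt x, Real.sqrt_pos.2 hx, Real.sq_sqrt (le_of_lt hx)⟩

/-- If an amplitude is Nakagami distributed, its square has a gamma density. -/
theorem hasLogConcaveExpDensity_map_sq_nakagamiDist {m v : ℝ} (hm : 0 < m) (hv : 0 < v) :
    HasLogConcaveExpDensity ((nakagamiDist m v).map fun t => t ^ 2) := by
  set c := m ^ m / (Real.Gamma m * v ^ m) with hc
  have hc0 : 0 < c := by
    have := Real.Gamma_pos_of_pos hm
    positivity
  refine hasLogConcaveExpDensity_of_exp (k := fun x => c * x ^ (m - 1) * Real.exp (-(m / v) * x))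
    -- The power `x ^ (m - 1)` becomes affine in `w`, whatever the sign of `m - 1`; this gives
    -- concavity for every `m > 0`.
    (φ := fun w => (Real.log c + (m - 1) * w) - m / v * Real.exp w) (by fun_prop) ?_ ?_ ?_
  · refine ConcaveOn.sub ⟨convex_univ, fun x _ y _ a b _ _ hab => le_of_eq ?_⟩
      (convexOn_exp.smul (by positivity : 0 ≤ m / v))
    simp only [smul_eq_mul]
    linear_combination Real.log c * hab
  · intro w
    rw [Real.exp_sub, Real.exp_add, Real.exp_log hc0, ← Real.exp_mul, mul_comm w, neg_mul,
      Real.exp_neg]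
    exact (div_eq_mul_inv _ _).symm
  · refine map_withDensity_of_hasDerivAt (φ' := fun t => 2 * t) measurableSet_Ioi measurableSet_Ioi
      (by fun_prop) (fun t _ => by simpa using hasDerivAt_pow 2 t) ?_ Set.image_sq_Ioi_zero ?_
    · intro s hs t ht h
      exact (pow_left_inj₀ (le_of_lt hs) (le_of_lt ht) two_ne_zero).1 h
    · intro t ht
      have ht0 : 0 < t := ht
      have e : t ^ (2 * m - 1) = t * (t ^ 2) ^ (m - 1) := by
        rw [← Real.rpow_natCast t 2, ← Real.rpow_mul ht0.le]
        nth_rewrite 2 [← Real.rpow_one t]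
        rw [← Real.rpow_add ht0]
        congr 1
        push_cast
        ring
      rw [abs_of_pos (by positivity), e, hc]
      ring

theorem rayleighDist_eq_nakagamiDist {σ : ℝ} (hσ : 0 < σ) :
    rayleighDist σ = nakagamiDist 1 (2 * σ ^ 2) := by
  unfold rayleighDist nakagamiDist
  congr 1
  funext x
  congr 1
  have h : (2 * 1 - 1 : ℝ) = 1 := by norm_num
  rw [Real.Gamma_one, Real.one_rpow, Real.rpow_one, h, Real.rpow_one]
  congr 1
  · field_simp
  · congr 1
    field_simp

theorem hasLogConcaveExpDensity_logNormalDist (a : ℝ) {v : NNReal} (hv : v ≠ 0) :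
    HasLogConcaveExpDensity (logNormalDist a v) := by
  have hv0 : (0 : ℝ) < v := by positivity
  have hs : 0 < (Real.sqrt (2 * Real.pi * v))⁻¹ := by positivity
  refine hasLogConcaveExpDensity_of_exp (k := fun x => gaussianPDFReal a v (Real.log x) / x)
    -- The Gaussian log-density at `w`, with the term `-w` coming from the factor `1 / x` at `x =
    -- exp w`.
    (φ := fun w => Real.log (Real.sqrt (2 * Real.pi * v))⁻¹ + -(w - a) ^ 2 / (2 * v) - w)
    (((measurable_gaussianPDFReal a v).comp Real.measurable_log).div measurable_id) ?_ ?_ ?_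
  · refine ⟨convex_univ, fun x _ y _ s t hs0 ht0 hst => ?_⟩
    obtain rfl : t = 1 - s := by linarith
    simp only [smul_eq_mul]
    have h : 0 ≤ s * (1 - s) * (x - y) ^ 2 / (2 * v) := by positivity
    have e : (s * x + (1 - s) * y - a) ^ 2 / (2 * v) + s * (1 - s) * (x - y) ^ 2 / (2 * v) =
        s * ((x - a) ^ 2 / (2 * v)) + (1 - s) * ((y - a) ^ 2 / (2 * v)) := by ring
    simp only [neg_div]
    nlinarith
  · intro w
    rw [Real.exp_sub, Real.exp_add, Real.exp_log hs, Real.log_exp, gaussianPDFReal]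
  · unfold logNormalDist
    rw [gaussianReal_of_var_ne_zero a hv]
    have := map_withDensity_of_hasDerivAt (D := Set.univ) (R := Set.Ioi 0) (φ := Real.exp)
      (φ' := Real.exp) (g := gaussianPDFReal a v)
      (k := fun x => gaussianPDFReal a v (Real.log x) / x)
      MeasurableSet.univ measurableSet_Ioi Real.measurable_exp
      (fun t _ => Real.hasDerivAt_exp t) Real.exp_injective.injOn
      (by rw [Set.image_univ, Real.range_exp]) (fun t _ => by
        rw [abs_of_pos (Real.exp_pos t), Real.log_exp]
        field_simp)
    rw [Measure.restrict_univ] at this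
    exact this

section Fading

variable {Ω : Type*} [MeasurableSpace Ω] {μ : Measure Ω}

theorem IsStandardFading.hasLogConcaveExpDensity {X : Ω → ℝ} (hX : Measurable X)
    (hX0 : ∀ᵐ ω ∂μ, 0 ≤ X ω) (h : IsStandardFading μ X) : HasLogConcaveExpDensity (μ.map X) := by
  -- Nonnegativity recovers the gain from its amplitude, so amplitude laws transfer by squaring.
  have hsq : μ.map X = (μ.map fun ω => Real.sqrt (X ω)).map fun t => t ^ 2 := by
    rw [Measure.map_map (by fun_prop) (by fun_prop)]
    refine Measure.map_congr ?_
    filter_upwards [hX0] with ω hω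
    exact (Real.sq_sqrt hω).symm
  rcases h with ⟨σ, hσ, h⟩ | ⟨m, v, hm, hv, h⟩ | ⟨a, v, hv, h⟩
  · rw [hsq, h, rayleighDist_eq_nakagamiDist hσ]
    exact hasLogConcaveExpDensity_map_sq_nakagamiDist one_pos (by positivity)
  · rw [hsq, h]
    exact hasLogConcaveExpDensity_map_sq_nakagamiDist (by linarith) hv
  · rw [h]
    exact hasLogConcaveExpDensity_logNormalDist a hv

theorem logConcaveFading_of_iIndepFun [IsProbabilityMeasure μ] {M : ℕ}
    {W : Fin M → Fin M → Ω → ℝ} (hW : ∀ i j, Measurable (W i j)) {i : Fin M}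
    (hind : iIndepFun (W i) μ) (h : ∀ j, HasLogConcaveExpDensity (μ.map (W i j))) :
    LogConcaveFading μ W i := by
  choose k mk k0 hk hμ using h
  refine ⟨fun w => ∏ j, k j (w j), ⟨?_, ?_, ?_⟩, ?_⟩
  · exact Finset.measurable_prod _ fun j _ => (mk j).comp (measurable_pi_apply j)
  · exact fun w => Finset.prod_nonneg fun j _ => k0 j _
  · have hprob : ∀ j, IsProbabilityMeasure
        ((volume : Measure ℝ).withDensity fun x => ENNReal.ofReal (k j x)) := fun j => by
      rw [← hμ j]
      exact Measure.isProbabilityMeasure_map (hW i j).aemeasurable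
    rw [(iIndepFun_iff_map_fun_eq_pi_map fun j => (hW i j).aemeasurable).1 hind]
    simp_rw [hμ]
    rw [Measure.pi_withDensity fun j => (mk j).ennreal_ofReal]
    simp_rw [ENNReal.ofReal_prod_of_nonneg fun j _ => k0 j _]
  · exact LogConcave.prod _ fun j _ => (hk j).comp_linearMap
      (LinearMap.proj (R := ℝ) (φ := fun _ : Fin M => ℝ) j)

end Fading

theorem theorem1 {Ω : Type*} [MeasurableSpace Ω] (μ : Measure Ω) [IsProbabilityMeasure μ]
    {M : ℕ} (W : Fin M → Fin M → Ω → ℝ)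
    (hW : ∀ i j, Measurable (W i j)) (hW0 : ∀ i j, ∀ᵐ ω ∂μ, 0 ≤ W i j ω)
    (N : Fin M → ℝ) (hN : ∀ i, 0 < N i) :
    -- the reliability function of a user `i` with log-concave fading is log-concave
    (∀ (i : Fin M) (f : (Fin M → ℝ) → ℝ), HasDensity μ (fun ω j => W i j ω) f →
      (∀ (S : ℝ) (P : Fin M → ℝ), reliability μ W N i S P =
        μ.real {ω | Real.log (W i i ω) >
          Real.log (Real.exp (S - P i + Real.log (N i)) +
            ∑ j ∈ Finset.univ.erase i, Real.exp (S - P i + P j + Real.log (W i j ω)))}) ∧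
      (LogConcave (fun w : Fin M → ℝ => f (fun j => Real.exp (w j))) →
        LogConcave (fun x : ℝ × (Fin M → ℝ) => reliability μ W N i x.1 x.2))) ∧
    -- if all users have log-concave fading, the minimization is a convex program
    ((∀ i, LogConcaveFading μ W i) →
      ∀ (L Pbar q : Fin M → ℝ) (J : (Fin M → ℝ) → ℝ),
        (∀ i, 0 < L i) → (∀ i, 0 < Pbar i) → (∀ i, q i ∈ Set.Icc (0 : ℝ) 1) →
        ConvexOn ℝ {T : Fin M → ℝ | ∀ i, 0 < T i} J →
        PosedAsConvexProgram μ W N L Pbar q J) ∧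
    -- this is so under independent Rayleigh, Nakagami or log-normal fading
    ((∀ i, iIndepFun (W i) μ) → (∀ i j, IsStandardFading μ (W i j)) →
      (∀ i, LogConcaveFading μ W i) ∧
      (∀ i, LogConcave (fun x : ℝ × (Fin M → ℝ) => reliability μ W N i x.1 x.2)) ∧
      ∀ (L Pbar q : Fin M → ℝ) (J : (Fin M → ℝ) → ℝ),
        (∀ i, 0 < L i) → (∀ i, 0 < Pbar i) → (∀ i, q i ∈ Set.Icc (0 : ℝ) 1) →
        ConvexOn ℝ {T : Fin M → ℝ | ∀ i, 0 < T i} J →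
        PosedAsConvexProgram μ W N L Pbar q J) := by
  have hconv : (∀ i, LogConcaveFading μ W i) →
      ∀ i, LogConcave (fun x : ℝ × (Fin M → ℝ) => reliability μ W N i x.1 x.2) := fun h i => by
    obtain ⟨f, hf, hlc⟩ := h i
    exact logConcave_reliability hW hW0 hN i hf hlc
  refine ⟨fun i f hf => ⟨reliability_eq_measureReal_log hW hW0 hN i hf,
    logConcave_reliability hW hW0 hN i hf⟩, fun h L Pbar q J hL hP _ hJ =>
    posedAsConvexProgram_of_logConcave hW (hconv h) hL hP hJ, fun hind hstd => ?_⟩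
  have hfad : ∀ i, LogConcaveFading μ W i := fun i =>
    logConcaveFading_of_iIndepFun hW (hind i) fun j =>
      (hstd i j).hasLogConcaveExpDensity (hW i j) (hW0 i j)
  exact ⟨hfad, hconv hfad, fun L Pbar q J hL hP _ hJ =>
    posedAsConvexProgram_of_logConcave hW (hconv hfad) hL hP hJ⟩
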